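/- Let $g(t) = 2t\log t + 2(1-t)\log(1-t) + 1$ for $t\in(0,1)$. There is exactly one probability distribution on $\mathbb{R}$ with mean $0$ and finite variance which solves the Quicksort equation $$X \stackrel{d}{=} U X_1 + (1-U) X_2 + g(U),$$ where $U, X_1, X_2$ are independent, $U$ is uniformly distributed on $(0,1)$ and $X_1, X_2$ have the same law as $X$; it is called the (limiting) Quicksort distribution. If $X$ has this distribution, then $$\lim_{x\to\infty} \frac{\log \mathbb{P}[X > x]}{x\log x} = -1 \qquad (25)$$ and $$\limsup_{x\to\infty} \frac{\log \mathbb{P}[X < -x]}{x\log x} \le -\frac{1}{2\log 2 - 1}, \qquad (24)$$ where the upper limit is taken in $[-\infty,\infty]$ and $\log 0 = -\infty$. -/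

import Mathlib

open MeasureTheory Set Filter Topology

/-- The toll function `g(t) = 2 t log t + 2 (1 - t) log (1 - t) + 1` of the Quicksort equation. -/
noncomputable def quicksortToll (t : ℝ) : ℝ :=
  2 * t * Real.log t + 2 * (1 - t) * Real.log (1 - t) + 1

/-- The uniform distribution on `(0, 1)`. -/
noncomputable def uniformUnit : Measure ℝ := volume.restrict (Ioo 0 1)

/-- The Quicksort smoothing transform: it maps `μ` to the law of `U X₁ + (1 - U) X₂ + g(U)`, where
`U` is uniform on `(0, 1)`, `X₁` and `X₂` have law `μ`, and `U`, `X₁`, `X₂` are independent. -/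
noncomputable def quicksortTransform (μ : Measure ℝ) : Measure ℝ :=
  (uniformUnit.prod (μ.prod μ)).map
    (fun p : ℝ × ℝ × ℝ => p.1 * p.2.1 + (1 - p.1) * p.2.2 + quicksortToll p.1)

/-- `μ` is a centered probability distribution on `ℝ` with finite variance that solves the
Quicksort equation `X = U X₁ + (1 - U) X₂ + g(U)` in law. -/
structure IsQuicksortLaw (μ : Measure ℝ) : Prop where
  isProbabilityMeasure : IsProbabilityMeasure μ
  memLp_two : MemLp (fun x : ℝ => x) 2 μ
  integral_eq_zero : ∫ x, x ∂μ = 0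
  fixedPoint : quicksortTransform μ = μ

/-! ### The toll function -/

/-! Existence and uniqueness come from a contraction. For the distance `sup |φ(t) - ψ(t)| / t ^ 2`
between characteristic functions, the transform has factor `E[U² + (1 - U)²] = 2/3`
(`charFun_quicksortTransform_contraction`). Centered laws with finite variance lie at finite
distance from each other, and Lévy's theorem turns the limit of the iterates from the Dirac mass at
`0` into a law.

Both upper tails come from one moment generating function bound, `exp (K (e ^ (c θ) - 1 - c θ))` for
`σ X`, where `c` bounds `σ g`: `c = 1` on the right and `c = 2 log 2 - 1` on the left, where `-g`
peaks at `1/2`. The transform preserves the bound once `K` is large (`integral_exp_le_one`), so it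
passes from the Dirac mass to the fixed point. Chernoff's inequality at `e ^ (c θ) = x` then gives
the rate `-1 / c`.

For the lower bound on the right, a uniform variable of size about `1 / x` lifts the level `x` by
nearly `1`, since `g` is close to `1` near `0` (`mul_measure_Ioi_le`). Repeating this about `x`
times costs about `x ^ (-x)`. -/

/-- Continuity, also at the endpoints, and the sharp bounds on the toll are then inherited from
binary entropy. -/
lemma quicksortToll_eq (t : ℝ) : quicksortToll t = 1 - 2 * Real.binEntropy t := by
  simp only [quicksortToll, Real.binEntropy, Real.log_inv]
  ring

lemma continuous_quicksortToll : Continuous quicksortToll := by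
  rw [funext quicksortToll_eq]
  fun_prop

@[fun_prop]
lemma measurable_quicksortToll : Measurable quicksortToll := continuous_quicksortToll.measurable

lemma quicksortToll_le_one {t : ℝ} (h0 : 0 ≤ t) (h1 : t ≤ 1) : quicksortToll t ≤ 1 := by
  rw [quicksortToll_eq]
  linarith [Real.binEntropy_nonneg h0 h1]

lemma neg_quicksortToll_le (t : ℝ) : -quicksortToll t ≤ 2 * Real.log 2 - 1 := by
  rw [quicksortToll_eq]
  linarith [Real.binEntropy_le_log_two (p := t)]

lemma two_mul_log_two_sub_one_pos : 0 < 2 * Real.log 2 - 1 := by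
  linarith [Real.log_two_gt_d9]

lemma two_mul_log_two_sub_one_le_one : 2 * Real.log 2 - 1 ≤ 1 := by
  linarith [Real.log_two_lt_d9]

lemma abs_quicksortToll_le_one {t : ℝ} (h0 : 0 ≤ t) (h1 : t ≤ 1) : |quicksortToll t| ≤ 1 :=
  abs_le.2 ⟨by linarith [neg_quicksortToll_le t, two_mul_log_two_sub_one_le_one],
    quicksortToll_le_one h0 h1⟩

instance isProbabilityMeasure_uniformUnit : IsProbabilityMeasure uniformUnit :=
  ⟨by simp [uniformUnit]⟩

lemma ae_uniformUnit_mem : ∀ᵐ u ∂uniformUnit, u ∈ Ioo (0 : ℝ) 1 :=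
  ae_restrict_mem measurableSet_Ioo

lemma integral_uniformUnit {E : Type*} [NormedAddCommGroup E] [NormedSpace ℝ E] (f : ℝ → E) :
    ∫ u, f u ∂uniformUnit = ∫ u in (0 : ℝ)..1, f u := by
  rw [uniformUnit, intervalIntegral.integral_of_le zero_le_one, integral_Ioc_eq_integral_Ioo]

lemma integrable_uniformUnit_of_continuous {E : Type*} [NormedAddCommGroup E] {f : ℝ → E}
    (hf : Continuous f) : Integrable f uniformUnit :=
  (hf.continuousOn.integrableOn_compact isCompact_Icc).mono_set Ioo_subset_Icc_self

lemma integral_mul_log_zero_one : ∫ u in (0 : ℝ)..1, u * Real.log u = -(1 / 4) := by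
  have h : ∀ x ∈ Ioo (0 : ℝ) 1,
      HasDerivAt (fun x : ℝ => x * (x * Real.log x) / 2 - x ^ 2 / 4) (x * Real.log x) x := by
    intro x hx
    have h1 := (((hasDerivAt_id' x).mul (Real.hasDerivAt_mul_log hx.1.ne')).div_const 2).sub
      (((hasDerivAt_id' x).pow 2).div_const 4)
    convert! h1 using 1
    simp
    ring
  rw [intervalIntegral.integral_eq_sub_of_hasDerivAt_of_le zero_le_one _ h]
  · norm_num
  · exact Real.continuous_mul_log.intervalIntegrable _ _
  · exact (((continuous_id.mul Real.continuous_mul_log).div_const 2).sub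
      ((continuous_id.pow 2).div_const 4)).continuousOn

lemma integral_quicksortToll : ∫ u, quicksortToll u ∂uniformUnit = 0 := by
  rw [integral_uniformUnit]
  have h1 : IntervalIntegrable (fun u : ℝ => u * Real.log u) volume 0 1 :=
    Real.continuous_mul_log.intervalIntegrable _ _
  have hc : Continuous fun u : ℝ => (1 - u) * Real.log (1 - u) :=
    Real.continuous_mul_log.comp (continuous_const.sub continuous_id)
  have h2 : IntervalIntegrable (fun u : ℝ => (1 - u) * Real.log (1 - u)) volume 0 1 :=
    hc.intervalIntegrable _ _
  have h3 : ∫ u in (0 : ℝ)..1, (1 - u) * Real.log (1 - u) = -(1 / 4) := by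
    rw [intervalIntegral.integral_comp_sub_left (fun u => u * Real.log u)]
    simpa using integral_mul_log_zero_one
  simp only [quicksortToll, mul_assoc]
  rw [intervalIntegral.integral_add ((h1.const_mul 2).add (h2.const_mul 2))
    intervalIntegrable_const, intervalIntegral.integral_add (h1.const_mul 2) (h2.const_mul 2),
    intervalIntegral.integral_const_mul, intervalIntegral.integral_const_mul, h3,
    integral_mul_log_zero_one]
  norm_num

/-! ### The key integral inequality for moment generating functions -/

/-- With `r = e ^ (s / 2)`, the right side is `r ^ 2 + 1 - e ^ (s u) - e ^ (s (1 - u))`. For `u ≤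
1/2`, the chords of `exp` over `[0, s / 2]` and `[s / 2, s]` bound the two exponentials and leave at
least `2 u (r - 1) ^ 2`. -/
lemma mul_sub_one_exp_lower_bound {s u : ℝ} (h0 : 0 ≤ u) (h1 : u ≤ 1) :
    u * (1 - u) * (2 * (Real.exp (s / 2) - 1) ^ 2) ≤
      (Real.exp (s * u) - 1) * (Real.exp (s * (1 - u)) - 1) := by
  wlog hu : u ≤ 1 / 2 generalizing u
  · have := this (u := 1 - u) (by linarith) (by linarith) (by linarith)
    rw [sub_sub_cancel] at this
    linarith
  have hs : Real.exp s = Real.exp (s / 2) ^ 2 := by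
    rw [← Real.exp_nat_mul]
    congr 1
    push_cast
    ring
  have hmul : Real.exp (s * u) * Real.exp (s * (1 - u)) = Real.exp (s / 2) ^ 2 := by
    rw [← Real.exp_add, ← hs]
    congr 1
    ring
  have e1 : Real.exp (s * u) ≤ (1 - 2 * u) + 2 * u * Real.exp (s / 2) := by
    have := convexOn_exp.2 (mem_univ 0) (mem_univ (s / 2))
      (by linarith : 0 ≤ 1 - 2 * u) (by linarith : 0 ≤ 2 * u) (by ring)
    simp only [smul_eq_mul, mul_zero, zero_add, Real.exp_zero, mul_one] at this
    rwa [show 2 * u * (s / 2) = s * u by ring] at this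
  have e2 : Real.exp (s * (1 - u)) ≤
      (1 - 2 * u) * Real.exp (s / 2) ^ 2 + 2 * u * Real.exp (s / 2) := by
    have := convexOn_exp.2 (mem_univ s) (mem_univ (s / 2))
      (by linarith : 0 ≤ 1 - 2 * u) (by linarith : 0 ≤ 2 * u) (by ring)
    simp only [smul_eq_mul] at this
    rwa [show (1 - 2 * u) * s + 2 * u * (s / 2) = s * (1 - u) by ring, hs] at this
  have hq := sq_nonneg (Real.exp (s / 2) - 1)
  nlinarith [mul_nonneg (mul_nonneg h0 h0) hq]

lemma integral_exp_neg_mul_le {z : ℝ} (hz : 0 < z) :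
    ∫ u in (0 : ℝ)..1, Real.exp (-(z * (u * (1 - u)))) ≤ 4 / z := by
  have hk : ∫ u in (0 : ℝ)..1, Real.exp (-(z / 2) * u) ≤ 2 / z := by
    rw [intervalIntegral.integral_comp_mul_left (fun u => Real.exp u) (by linarith), integral_exp]
    simp only [mul_zero, mul_one, Real.exp_zero, smul_eq_mul]
    rw [show (-(z / 2))⁻¹ * (Real.exp (-(z / 2)) - 1) = 2 / z * (1 - Real.exp (-(z / 2))) by
      field_simp; ring]
    exact mul_le_of_le_one_right (by positivity) (by linarith [Real.exp_pos (-(z / 2))])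
  have hk' : ∫ u in (0 : ℝ)..1, Real.exp (-(z / 2) * (1 - u)) ≤ 2 / z := by
    rw [intervalIntegral.integral_comp_sub_left (fun u => Real.exp (-(z / 2) * u))]
    simpa using hk
  -- On each half of the interval, `u (1 - u)` is at least half the distance to the nearer endpoint.
  have hb : ∫ u in (0 : ℝ)..1, Real.exp (-(z * (u * (1 - u)))) ≤
      ∫ u in (0 : ℝ)..1, (Real.exp (-(z / 2) * u) + Real.exp (-(z / 2) * (1 - u))) := by
    apply intervalIntegral.integral_mono_on zero_le_one
      (Continuous.intervalIntegrable (by fun_prop) _ _)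
      (Continuous.intervalIntegrable (by fun_prop) _ _)
    rintro u ⟨h0, h1⟩
    rcases le_total u (1 / 2) with h | h
    · refine le_add_of_le_of_nonneg (Real.exp_le_exp.2 ?_) (Real.exp_pos _).le
      nlinarith [mul_nonneg hz.le (mul_nonneg h0 (by linarith : 0 ≤ 1 / 2 - u))]
    · refine le_add_of_nonneg_of_le (Real.exp_pos _).le (Real.exp_le_exp.2 ?_)
      nlinarith [mul_nonneg hz.le (mul_nonneg (by linarith : 0 ≤ 1 - u) (by linarith : 0 ≤ u - 1 / 2))]
  rw [intervalIntegral.integral_add (Continuous.intervalIntegrable (by fun_prop) _ _)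
    (Continuous.intervalIntegrable (by fun_prop) _ _)] at hb
  calc _ ≤ 2 / z + 2 / z := hb.trans (add_le_add hk hk')
    _ = 4 / z := by ring

lemma exp_sub_le_of_small {x y : ℝ} (hx : |x| ≤ 1) (hy0 : 0 ≤ y) (hy1 : y ≤ 1) :
    Real.exp (x - y) ≤ 1 + x + x ^ 2 - y / 6 := by
  have h1 : Real.exp x ≤ 1 + x + x ^ 2 := by
    have := Real.norm_exp_sub_one_sub_id_le (x := x) hx
    simp only [Real.norm_eq_abs, sq_abs] at this
    linarith [le_abs_self (Real.exp x - 1 - x)]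
  have h2 : Real.exp (-y) ≤ 1 - y / 2 := by
    have := convexOn_exp.2 (mem_univ 0) (mem_univ (-1)) 
      (by linarith : 0 ≤ 1 - y) hy0 (by ring)
    simp only [smul_eq_mul, mul_zero, zero_add, Real.exp_zero, mul_one, mul_neg] at this
    nlinarith [Real.exp_neg_one_lt_half]
  have h3 : 1 / 3 ≤ Real.exp x := by
    have h4 : Real.exp (-1) ≤ Real.exp x := Real.exp_le_exp.2 (abs_le.1 hx).1
    have h5 : Real.exp (-1) * Real.exp 1 = 1 := by rw [← Real.exp_add]; simp
    nlinarith [Real.exp_one_lt_d9, Real.exp_pos (-1)]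
  rw [sub_eq_add_neg, Real.exp_add]
  nlinarith [mul_le_mul_of_nonneg_left h2 (Real.exp_pos x).le, mul_le_mul_of_nonneg_right h3 hy0]

/-- The constant in the exponent of the moment generating function bound. -/
noncomputable def mgfConst (c : ℝ) : ℝ := 72 / c ^ 2 + 2 / (1 - Real.exp (-(c / 6))) ^ 2

lemma mgfConst_pos {c : ℝ} (hc : 0 < c) : 0 < mgfConst c := by
  unfold mgfConst
  positivity

/-- This is the inductive step of the moment generating function bound with `f = σ g`. For small `θ`
the vanishing mean of `f` leaves an error of order `θ ^ 2`, absorbed by the first summand of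
`mgfConst`. For large `θ` only `f ≤ c` is used, and the second summand makes the penalty beat `e ^
(c θ)`. -/
lemma integral_exp_le_one {f : ℝ → ℝ} (hf : Continuous f) {c : ℝ} (hc : 0 < c)
    (hfc : ∀ u ∈ Ioo (0 : ℝ) 1, f u ≤ c) (hf1 : ∀ u ∈ Ioo (0 : ℝ) 1, |f u| ≤ 1)
    (hf0 : ∫ u, f u ∂uniformUnit = 0) {θ : ℝ} (hθ : 0 ≤ θ) :
    ∫ u, Real.exp (θ * f u - mgfConst c *
      ((Real.exp (c * θ * u) - 1) * (Real.exp (c * θ * (1 - u)) - 1))) ∂uniformUnit ≤ 1 := by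
  set A := mgfConst c with hA
  have hA0 : 0 < A := mgfConst_pos hc
  set q := 2 * (Real.exp (c * θ / 2) - 1) ^ 2 with hq
  have hint : Integrable (fun u => Real.exp (θ * f u - A *
      ((Real.exp (c * θ * u) - 1) * (Real.exp (c * θ * (1 - u)) - 1)))) uniformUnit :=
    integrable_uniformUnit_of_continuous (by fun_prop)
  have hlow : ∀ u ∈ Ioo (0 : ℝ) 1, A * q * (u * (1 - u)) ≤ A *
      ((Real.exp (c * θ * u) - 1) * (Real.exp (c * θ * (1 - u)) - 1)) := by
    intro u hu
    have := mul_le_mul_of_nonneg_left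
      (mul_sub_one_exp_lower_bound (s := c * θ) hu.1.le hu.2.le) hA0.le
    linarith
  -- At `θ = 1/3` the quantity `36 θ ^ 2 u (1 - u)` still stays below `1`, as `exp_sub_le_of_small`
  -- requires.
  rcases le_total θ (1 / 3) with h | h
  · have hAq : 36 * θ ^ 2 ≤ A * q := by
      have h1 : 72 / c ^ 2 ≤ A := by
        rw [hA, mgfConst]
        exact le_add_of_nonneg_right (by positivity)
      have h2 : c ^ 2 * θ ^ 2 / 2 ≤ q := by
        have h3 : c * θ / 2 ≤ Real.exp (c * θ / 2) - 1 := by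
          linarith [Real.add_one_le_exp (c * θ / 2)]
        have h4 := mul_self_le_mul_self (by positivity) h3
        rw [hq]
        linarith
      calc 36 * θ ^ 2 = 72 / c ^ 2 * (c ^ 2 * θ ^ 2 / 2) := by field_simp; ring
        _ ≤ A * q := mul_le_mul h1 h2 (by positivity) hA0.le
    have hb : ∀ᵐ u ∂uniformUnit, Real.exp (θ * f u - A *
        ((Real.exp (c * θ * u) - 1) * (Real.exp (c * θ * (1 - u)) - 1))) ≤
        (1 + θ ^ 2 - 6 * θ ^ 2 * (u * (1 - u))) + θ * f u := by
      filter_upwards [ae_uniformUnit_mem] with u hu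
      have hu' : 0 ≤ u * (1 - u) := mul_nonneg hu.1.le (by linarith [hu.2])
      have hu4 : u * (1 - u) ≤ 1 / 4 := by nlinarith [sq_nonneg (u - 1 / 2)]
      have hx : |θ * f u| ≤ θ := by
        rw [abs_mul, abs_of_nonneg hθ]
        exact mul_le_of_le_one_right hθ (hf1 u hu)
      have hx2 : (θ * f u) ^ 2 ≤ θ ^ 2 := by
        rw [← sq_abs (θ * f u)]
        exact pow_le_pow_left₀ (abs_nonneg _) hx 2
      have hθ9 : θ ^ 2 ≤ 1 / 9 := by nlinarith
      have := exp_sub_le_of_small (x := θ * f u) (y := 36 * θ ^ 2 * (u * (1 - u)))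
        (by linarith) (by positivity) (by nlinarith [mul_nonneg (sq_nonneg θ) hu'])
      refine (Real.exp_le_exp.2 ?_).trans (this.trans (by linarith))
      linarith [hlow u hu, mul_le_mul_of_nonneg_right hAq hu']
    -- Since `u (1 - u)` has mean `1/6`, the two `θ ^ 2` terms cancel exactly; this fixes the
    -- constant `36`.
    refine (integral_mono_ae hint (integrable_uniformUnit_of_continuous (by fun_prop)) hb).trans ?_
    rw [integral_add (integrable_uniformUnit_of_continuous (by fun_prop))
      (integrable_uniformUnit_of_continuous (by fun_prop)), integral_const_mul, hf0,
      integral_uniformUnit]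
    have : ∀ u : ℝ, 1 + θ ^ 2 - 6 * θ ^ 2 * (u * (1 - u)) =
        (1 + θ ^ 2) - 6 * θ ^ 2 * u + 6 * θ ^ 2 * u ^ 2 := fun u => by ring
    simp_rw [this]
    rw [intervalIntegral.integral_add (Continuous.intervalIntegrable (by fun_prop) _ _)
      (Continuous.intervalIntegrable (by fun_prop) _ _),
      intervalIntegral.integral_sub (Continuous.intervalIntegrable (by fun_prop) _ _)
      (Continuous.intervalIntegrable (by fun_prop) _ _), intervalIntegral.integral_const_mul,
      intervalIntegral.integral_const_mul]
    simp only [intervalIntegral.integral_const, integral_id, integral_pow, smul_eq_mul]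
    norm_num
    linarith
  · have hθ' : 0 < θ := by linarith
    have hE : 0 < 1 - Real.exp (-(c / 6)) := by
      have := Real.exp_lt_exp.2 (show -(c / 6) < 0 by linarith)
      rw [Real.exp_zero] at this
      linarith
    have hexp : Real.exp (c * θ) = Real.exp (c * θ / 2) ^ 2 := by
      rw [← Real.exp_nat_mul]
      congr 1
      push_cast
      ring
    have hAq : 4 * Real.exp (c * θ) ≤ A * q := by
      have h1 : 2 / (1 - Real.exp (-(c / 6))) ^ 2 ≤ A := by
        rw [hA, mgfConst]
        exact le_add_of_nonneg_left (by positivity)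
      have h2 : 2 * (Real.exp (c * θ) * (1 - Real.exp (-(c / 6))) ^ 2) ≤ q := by
        rw [hq, hexp, ← mul_pow]
        have h3 : Real.exp (-(c * θ / 2)) ≤ Real.exp (-(c / 6)) := by
          apply Real.exp_le_exp.2
          nlinarith
        have h4 : Real.exp (c * θ / 2) * Real.exp (-(c * θ / 2)) = 1 := by
          rw [← Real.exp_add]
          simp
        have h5 := mul_le_mul_of_nonneg_left h3 (Real.exp_pos (c * θ / 2)).le
        refine mul_le_mul_of_nonneg_left (pow_le_pow_left₀ (by positivity) ?_ 2) (by norm_num)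
        linarith
      calc 4 * Real.exp (c * θ) = 2 / (1 - Real.exp (-(c / 6))) ^ 2 *
            (2 * (Real.exp (c * θ) * (1 - Real.exp (-(c / 6))) ^ 2)) := by field_simp; ring
        _ ≤ A * q := mul_le_mul h1 h2 (by positivity) hA0.le
    have hAq0 : 0 < A * q := lt_of_lt_of_le (by positivity) hAq
    have hb : ∀ᵐ u ∂uniformUnit, Real.exp (θ * f u - A *
        ((Real.exp (c * θ * u) - 1) * (Real.exp (c * θ * (1 - u)) - 1))) ≤
        Real.exp (c * θ) * Real.exp (-(A * q * (u * (1 - u)))) := by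
      filter_upwards [ae_uniformUnit_mem] with u hu
      rw [← Real.exp_add]
      apply Real.exp_le_exp.2
      linarith [hlow u hu, mul_le_mul_of_nonneg_left (hfc u hu) hθ]
    refine (integral_mono_ae hint (integrable_uniformUnit_of_continuous (by fun_prop)) hb).trans ?_
    rw [integral_const_mul, integral_uniformUnit]
    calc _ ≤ Real.exp (c * θ) * (4 / (A * q)) :=
          mul_le_mul_of_nonneg_left (integral_exp_neg_mul_le hAq0) (Real.exp_pos _).le
      _ = 4 * Real.exp (c * θ) / (A * q) := by ring
      _ ≤ 1 := (div_le_one hAq0).2 hAq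

/-! ### The Quicksort transform and characteristic functions -/

@[fun_prop]
lemma measurable_quicksortMap : Measurable
    (fun p : ℝ × ℝ × ℝ => p.1 * p.2.1 + (1 - p.1) * p.2.2 + quicksortToll p.1) := by
  fun_prop

instance isProbabilityMeasure_quicksortTransform (μ : Measure ℝ) [IsProbabilityMeasure μ] :
    IsProbabilityMeasure (quicksortTransform μ) :=
  Measure.isProbabilityMeasure_map measurable_quicksortMap.aemeasurable

lemma integrable_bounded_charFun_kernel (μ : Measure ℝ) [IsProbabilityMeasure μ] (t : ℝ) :
    Integrable (fun u : ℝ => charFun μ (u * t) * charFun μ ((1 - u) * t) *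
      Complex.exp (t * quicksortToll u * Complex.I)) uniformUnit := by
  refine Integrable.of_bound (C := 1) ?_ (ae_of_all _ fun u => ?_)
  · have h : Continuous (charFun μ) := continuous_charFun
    have := continuous_quicksortToll
    exact (by fun_prop : Continuous _).aestronglyMeasurable
  · rw [norm_mul, norm_mul, ← Complex.ofReal_mul, Complex.norm_exp_ofReal_mul_I, mul_one]
    exact mul_le_one₀ (norm_charFun_le_one _) (norm_nonneg _) (norm_charFun_le_one _)

lemma charFun_quicksortTransform (μ : Measure ℝ) [IsProbabilityMeasure μ] (t : ℝ) :
    charFun (quicksortTransform μ) t =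
      ∫ u, charFun μ (u * t) * charFun μ ((1 - u) * t) *
        Complex.exp (t * quicksortToll u * Complex.I) ∂uniformUnit := by
  rw [charFun_apply_real, quicksortTransform, integral_map measurable_quicksortMap.aemeasurable
    (by fun_prop), integral_prod]
  · refine integral_congr_ae (ae_of_all _ fun u => ?_)
    simp only [charFun_apply_real]
    rw [← integral_prod_mul, ← integral_mul_const]
    refine integral_congr_ae (ae_of_all _ fun p => ?_)
    simp only
    rw [← Complex.exp_add, ← Complex.exp_add]
    congr 1
    push_cast
    ring
  · refine Integrable.of_bound (C := 1) (by fun_prop) (ae_of_all _ fun p => ?_)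
    rw [← Complex.ofReal_mul, Complex.norm_exp_ofReal_mul_I]

/-- The toll only contributes a factor of modulus `1`. Telescoping the product of two characteristic
functions gives `u ^ 2 + (1 - u) ^ 2`, whose mean is `2/3`. -/
lemma charFun_quicksortTransform_contraction {μ ν : Measure ℝ} [IsProbabilityMeasure μ]
    [IsProbabilityMeasure ν] {D : ℝ} (h : ∀ t, ‖charFun μ t - charFun ν t‖ ≤ D * t ^ 2) (t : ℝ) :
    ‖charFun (quicksortTransform μ) t - charFun (quicksortTransform ν) t‖ ≤
      2 / 3 * D * t ^ 2 := by
  rw [charFun_quicksortTransform, charFun_quicksortTransform,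
    ← integral_sub (integrable_bounded_charFun_kernel μ t) (integrable_bounded_charFun_kernel ν t)]
  have hb : ∀ u : ℝ, ‖charFun μ (u * t) * charFun μ ((1 - u) * t) *
        Complex.exp (t * quicksortToll u * Complex.I) -
      charFun ν (u * t) * charFun ν ((1 - u) * t) *
        Complex.exp (t * quicksortToll u * Complex.I)‖ ≤
      D * t ^ 2 * (u ^ 2 + (1 - u) ^ 2) := by
    intro u
    rw [← sub_mul, norm_mul, ← Complex.ofReal_mul, Complex.norm_exp_ofReal_mul_I, mul_one]
    calc ‖charFun μ (u * t) * charFun μ ((1 - u) * t) -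
          charFun ν (u * t) * charFun ν ((1 - u) * t)‖
        = ‖(charFun μ (u * t) - charFun ν (u * t)) * charFun μ ((1 - u) * t) +
          charFun ν (u * t) * (charFun μ ((1 - u) * t) - charFun ν ((1 - u) * t))‖ := by
          congr 1
          ring
      _ ≤ ‖charFun μ (u * t) - charFun ν (u * t)‖ * ‖charFun μ ((1 - u) * t)‖ +
          ‖charFun ν (u * t)‖ * ‖charFun μ ((1 - u) * t) - charFun ν ((1 - u) * t)‖ := by
          rw [← norm_mul, ← norm_mul]
          exact norm_add_le _ _
      _ ≤ ‖charFun μ (u * t) - charFun ν (u * t)‖ +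
          ‖charFun μ ((1 - u) * t) - charFun ν ((1 - u) * t)‖ :=
          add_le_add (mul_le_of_le_one_right (norm_nonneg _) (norm_charFun_le_one _))
            (mul_le_of_le_one_left (norm_nonneg _) (norm_charFun_le_one _))
      _ ≤ D * (u * t) ^ 2 + D * ((1 - u) * t) ^ 2 := add_le_add (h _) (h _)
      _ = D * t ^ 2 * (u ^ 2 + (1 - u) ^ 2) := by ring
  refine (norm_integral_le_of_norm_le (integrable_uniformUnit_of_continuous (by fun_prop))
    (ae_of_all _ hb)).trans ?_
  rw [integral_const_mul, integral_uniformUnit]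
  have : ∀ u : ℝ, u ^ 2 + (1 - u) ^ 2 = 1 - 2 * u + 2 * u ^ 2 := fun u => by ring
  simp_rw [this]
  rw [intervalIntegral.integral_add (Continuous.intervalIntegrable (by fun_prop) _ _)
    (Continuous.intervalIntegrable (by fun_prop) _ _),
    intervalIntegral.integral_sub (Continuous.intervalIntegrable (by fun_prop) _ _)
    (Continuous.intervalIntegrable (by fun_prop) _ _), intervalIntegral.integral_const_mul,
    intervalIntegral.integral_const_mul]
  simp only [intervalIntegral.integral_const, integral_id, integral_pow, smul_eq_mul]
  norm_num
  linarith

lemma norm_exp_mul_I_sub_one_sub_le (x : ℝ) :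
    ‖Complex.exp (x * Complex.I) - 1 - x * Complex.I‖ ≤ 3 * x ^ 2 := by
  have hx : ‖(x : ℂ) * Complex.I‖ = |x| := by simp
  rcases le_total |x| 1 with h | h
  · refine (Complex.norm_exp_sub_one_sub_id_le (hx.trans_le h)).trans ?_
    rw [hx, sq_abs]
    linarith [sq_nonneg x]
  · have h1 : ‖Complex.exp (x * Complex.I) - 1 - x * Complex.I‖ ≤ 1 + 1 + |x| := by
      refine (norm_sub_le _ _).trans (add_le_add ((norm_sub_le _ _).trans (add_le_add ?_ ?_)) hx.le)
      · rw [Complex.norm_exp_ofReal_mul_I]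
      · simp
    have h2 := sq_abs x
    nlinarith

/-- Centering removes the linear term, which puts the law at finite distance from the Dirac mass at
`0`. -/
lemma norm_charFun_sub_one_le {μ : Measure ℝ} [IsProbabilityMeasure μ]
    (h2 : MemLp (fun x : ℝ => x) 2 μ) (h0 : ∫ x, x ∂μ = 0) (t : ℝ) :
    ‖charFun μ t - 1‖ ≤ 3 * (∫ x, x ^ 2 ∂μ) * t ^ 2 := by
  have hi : Integrable (fun x : ℝ => x) μ := h2.integrable (by norm_num)
  have hi' : Integrable (fun x : ℝ => ((t * x : ℝ) : ℂ) * Complex.I) μ :=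
    ((hi.const_mul t).ofReal).mul_const _
  have he : Integrable (fun x : ℝ => Complex.exp ((t * x : ℝ) * Complex.I)) μ :=
    Integrable.of_bound (C := 1) (by fun_prop)
      (ae_of_all _ fun x => (Complex.norm_exp_ofReal_mul_I _).le)
  have hz : ∫ x : ℝ, ((t * x : ℝ) : ℂ) * Complex.I ∂μ = 0 := by
    rw [integral_mul_const, integral_complex_ofReal, integral_const_mul, h0]
    simp
  have key : charFun μ t - 1 =
      ∫ x : ℝ, (Complex.exp ((t * x : ℝ) * Complex.I) - 1 - (t * x : ℝ) * Complex.I) ∂μ := by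
    have h1 := integral_sub (he.sub (integrable_const (1 : ℂ))) hi'
    have h3 := integral_sub he (integrable_const (1 : ℂ))
    simp only [Pi.sub_apply] at h1
    rw [h1, h3, hz, charFun_apply_real]
    simp
  rw [key]
  refine (norm_integral_le_of_norm_le (h2.integrable_sq.const_mul (3 * t ^ 2))
    (ae_of_all _ fun x => ?_)).trans_eq ?_
  · exact (norm_exp_mul_I_sub_one_sub_le (t * x)).trans_eq (by ring)
  · rw [integral_const_mul]
    ring

theorem IsQuicksortLaw.unique {μ ν : Measure ℝ} (hμ : IsQuicksortLaw μ) (hν : IsQuicksortLaw ν) :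
    μ = ν := by
  have := hμ.isProbabilityMeasure
  have := hν.isProbabilityMeasure
  set D := 3 * (∫ x, x ^ 2 ∂μ) + 3 * (∫ x, x ^ 2 ∂ν)
  have h0 : ∀ t, ‖charFun μ t - charFun ν t‖ ≤ D * t ^ 2 := by
    intro t
    have h1 := norm_charFun_sub_one_le hμ.memLp_two hμ.integral_eq_zero t
    have h2 := norm_charFun_sub_one_le hν.memLp_two hν.integral_eq_zero t
    calc ‖charFun μ t - charFun ν t‖ = ‖(charFun μ t - 1) - (charFun ν t - 1)‖ := by
          congr 1
          ring
      _ ≤ _ := (norm_sub_le _ _).trans (add_le_add h1 h2)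
      _ = D * t ^ 2 := by ring
  have hn : ∀ n : ℕ, ∀ t, ‖charFun μ t - charFun ν t‖ ≤ ((2 / 3) ^ n * D) * t ^ 2 := by
    intro n
    induction n with
    | zero => simpa using h0
    | succ n ih =>
      intro t
      have := charFun_quicksortTransform_contraction ih t
      rw [hμ.fixedPoint, hν.fixedPoint] at this
      exact this.trans_eq (by ring)
  refine Measure.ext_of_charFun (funext fun t => ?_)
  have hlim : Tendsto (fun n : ℕ => ((2 / 3 : ℝ) ^ n * D) * t ^ 2) atTop (𝓝 0) := by
    simpa using ((tendsto_pow_atTop_nhds_zero_of_lt_one (r := (2 / 3 : ℝ)) (by norm_num)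
      (by norm_num)).mul_const D).mul_const (t ^ 2)
  have := ge_of_tendsto' hlim fun n => hn n t
  exact sub_eq_zero.1 (norm_le_zero_iff.1 this)

/-! ### Moment generating functions -/

lemma lintegral_exp_quicksortTransform (μ : Measure ℝ) [IsProbabilityMeasure μ] (θ : ℝ) :
    ∫⁻ x, ENNReal.ofReal (Real.exp (θ * x)) ∂(quicksortTransform μ) =
      ∫⁻ u, (∫⁻ x, ENNReal.ofReal (Real.exp (θ * u * x)) ∂μ) *
        (∫⁻ x, ENNReal.ofReal (Real.exp (θ * (1 - u) * x)) ∂μ) *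
        ENNReal.ofReal (Real.exp (θ * quicksortToll u)) ∂uniformUnit := by
  rw [quicksortTransform, lintegral_map (by fun_prop) measurable_quicksortMap,
    lintegral_prod _ (by fun_prop)]
  refine lintegral_congr fun u => ?_
  rw [← lintegral_prod_mul (by fun_prop) (by fun_prop), ← lintegral_mul_const _ (by fun_prop)]
  refine lintegral_congr fun p => ?_
  rw [← ENNReal.ofReal_mul (Real.exp_pos _).le, ← ENNReal.ofReal_mul (by positivity),
    ← Real.exp_add, ← Real.exp_add]
  congr 2
  ring

/-- The moment generating function of `σ X`, where `X` has law `μ`, is bounded by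
`exp (K (e ^ (c θ) - 1 - c θ))` at all `θ ≥ 0`, with `K = mgfConst c`. -/
def MGFBound (σ c : ℝ) (μ : Measure ℝ) : Prop :=
  ∀ θ : ℝ, 0 ≤ θ → ∫⁻ x, ENNReal.ofReal (Real.exp (θ * σ * x)) ∂μ ≤
    ENNReal.ofReal (Real.exp (mgfConst c * (Real.exp (c * θ) - 1 - c * θ)))

/-- For `φ(θ) = K (e ^ (c θ) - 1 - c θ)`, the linear terms cancel and `φ(θ u) + φ(θ (1 - u)) - φ(θ)
= -K (e ^ (c θ u) - 1) (e ^ (c θ (1 - u)) - 1)`. The claim thus reduces to `integral_exp_le_one`. -/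
lemma MGFBound.quicksortTransform {σ c : ℝ} {μ : Measure ℝ} [IsProbabilityMeasure μ]
    (hσ : |σ| = 1) (hc : 0 < c) (hfc : ∀ u ∈ Ioo (0 : ℝ) 1, σ * quicksortToll u ≤ c)
    (h : MGFBound σ c μ) : MGFBound σ c (quicksortTransform μ) := by
  intro θ hθ
  set K := mgfConst c with hK
  set φ : ℝ → ℝ := fun θ => K * (Real.exp (c * θ) - 1 - c * θ) with hφ
  set F : ℝ → ℝ := fun u => Real.exp (θ * (σ * quicksortToll u) - K *
    ((Real.exp (c * θ * u) - 1) * (Real.exp (c * θ * (1 - u)) - 1))) with hF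
  have hFc : Continuous F := by
    have := continuous_quicksortToll
    fun_prop
  rw [lintegral_exp_quicksortTransform]
  have hb : ∀ᵐ u ∂uniformUnit, (∫⁻ x, ENNReal.ofReal (Real.exp (θ * σ * u * x)) ∂μ) *
        (∫⁻ x, ENNReal.ofReal (Real.exp (θ * σ * (1 - u) * x)) ∂μ) *
        ENNReal.ofReal (Real.exp (θ * σ * quicksortToll u)) ≤
      ENNReal.ofReal (Real.exp (φ θ)) * ENNReal.ofReal (F u) := by
    filter_upwards [ae_uniformUnit_mem] with u hu
    have h1 := h (θ * u) (mul_nonneg hθ hu.1.le)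
    have h2 := h (θ * (1 - u)) (mul_nonneg hθ (by linarith [hu.2]))
    rw [mul_right_comm θ u σ] at h1
    rw [mul_right_comm θ (1 - u) σ] at h2
    refine (mul_le_mul_left (mul_le_mul' h1 h2) _).trans_eq ?_
    rw [← ENNReal.ofReal_mul (Real.exp_pos _).le, ← ENNReal.ofReal_mul (by positivity),
      ← ENNReal.ofReal_mul (Real.exp_pos _).le, ← Real.exp_add, ← Real.exp_add, hF, ← Real.exp_add]
    congr 2
    have he : Real.exp (c * θ) = Real.exp (c * θ * u) * Real.exp (c * θ * (1 - u)) := by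
      rw [← Real.exp_add]
      congr 1
      ring
    simp only [hφ]
    rw [he, ← mul_assoc c θ u, ← mul_assoc c θ (1 - u)]
    ring
  refine (lintegral_mono_ae hb).trans ?_
  rw [lintegral_const_mul _ hFc.measurable.ennreal_ofReal]
  refine mul_le_of_le_one_right (zero_le) ?_
  rw [← ofReal_integral_eq_lintegral_ofReal (integrable_uniformUnit_of_continuous hFc)
    (ae_of_all _ fun u => (Real.exp_pos _).le)]
  refine ENNReal.ofReal_le_one.2 (integral_exp_le_one (continuous_quicksortToll.const_mul σ) hc
    hfc (fun u hu => ?_) ?_ hθ)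
  · rw [abs_mul, hσ, one_mul]
    exact abs_quicksortToll_le_one hu.1.le hu.2.le
  · rw [integral_const_mul, integral_quicksortToll, mul_zero]

lemma MGFBound.dirac_zero (σ c : ℝ) (hc : 0 < c) : MGFBound σ c (Measure.dirac 0) := by
  intro θ _
  rw [lintegral_dirac, mul_zero, Real.exp_zero]
  refine ENNReal.ofReal_le_ofReal (Real.one_le_exp (mul_nonneg (mgfConst_pos hc).le ?_))
  linarith [Real.add_one_le_exp (c * θ)]

lemma MGFBound.integrable_exp {σ c : ℝ} {μ : Measure ℝ} (h : MGFBound σ c μ) {θ : ℝ}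
    (hθ : 0 ≤ θ) : Integrable (fun x => Real.exp (θ * σ * x)) μ := by
  refine ⟨by fun_prop, ?_⟩
  rw [hasFiniteIntegral_iff_ofReal (ae_of_all _ fun x => (Real.exp_pos _).le)]
  exact (h θ hθ).trans_lt ENNReal.ofReal_lt_top

lemma MGFBound.integral_exp_le {σ c : ℝ} {μ : Measure ℝ} (h : MGFBound σ c μ) {θ : ℝ}
    (hθ : 0 ≤ θ) : ∫ x, Real.exp (θ * σ * x) ∂μ ≤
      Real.exp (mgfConst c * (Real.exp (c * θ) - 1 - c * θ)) := by
  have := h θ hθ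
  rwa [← ofReal_integral_eq_lintegral_ofReal (h.integrable_exp hθ)
    (ae_of_all _ fun x => (Real.exp_pos _).le),
    ENNReal.ofReal_le_ofReal_iff (Real.exp_pos _).le] at this

/-- The bound equals `1` with zero derivative at `θ = 0`, while `e ^ y ≥ 1 + y` makes the mean a
lower bound for its difference quotients from the right. Using both signs of `σ` centers the law. -/
lemma MGFBound.mul_integral_nonpos {σ c : ℝ} {μ : Measure ℝ} [IsProbabilityMeasure μ]
    (h : MGFBound σ c μ) (hi : Integrable (fun x : ℝ => x) μ) : σ * ∫ x, x ∂μ ≤ 0 := by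
  set G : ℝ → ℝ := fun θ => Real.exp (mgfConst c * (Real.exp (c * θ) - 1 - c * θ)) with hG
  have hle : ∀ θ, 0 ≤ θ → θ * (σ * ∫ x, x ∂μ) ≤ G θ - 1 := by
    intro θ hθ
    have h1 : ∫ x, (θ * σ * x + 1) ∂μ ≤ ∫ x, Real.exp (θ * σ * x) ∂μ :=
      integral_mono ((hi.const_mul _).add (integrable_const _)) (h.integrable_exp hθ)
        fun x => Real.add_one_le_exp _
    rw [integral_add (hi.const_mul _) (integrable_const _), integral_const_mul] at h1
    simp only [integral_const, probReal_univ, smul_eq_mul, mul_one] at h1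
    have := h1.trans (h.integral_exp_le hθ)
    linarith
  have hd : HasDerivAt G 0 0 := by
    have h1 : HasDerivAt (fun θ : ℝ => c * θ) c 0 := by
      simpa using (hasDerivAt_id (0 : ℝ)).const_mul c
    have h2 := (((h1.exp.sub_const 1).sub h1).const_mul (mgfConst c)).exp
    simpa using h2
  have hG0 : G 0 = 1 := by simp [hG]
  have hs := hd.tendsto_slope.mono_left (nhdsWithin_mono (0 : ℝ) (s := Ioi 0)
    fun x hx => (ne_of_gt hx : x ≠ 0))
  refine ge_of_tendsto hs ?_
  filter_upwards [self_mem_nhdsWithin] with θ hθ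
  rw [slope_def_field, hG0, sub_zero, le_div_iff₀ hθ, mul_comm]
  exact hle θ (le_of_lt hθ)

lemma MGFBound.memLp_two {c c' : ℝ} {μ : Measure ℝ} (h : MGFBound 1 c μ)
    (h' : MGFBound (-1) c' μ) : MemLp (fun x : ℝ => x) 2 μ := by
  refine (memLp_two_iff_integrable_sq (by fun_prop)).2 ?_
  refine (((h.integrable_exp zero_le_one).add (h'.integrable_exp zero_le_one)).const_mul 2).mono'
    (by fun_prop) (ae_of_all _ fun x => ?_)
  simp only [Pi.add_apply, Real.norm_eq_abs, abs_pow, sq_abs]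
  have h3 : ∀ y : ℝ, 0 ≤ y → y ^ 2 ≤ 2 * Real.exp y := fun y hy => by
    linarith [Real.quadratic_le_exp_of_nonneg hy]
  rcases le_total 0 x with hx | hx
  · have := h3 x hx
    simp only [one_mul, mul_one]
    linarith [Real.exp_pos (-1 * x)]
  · have := h3 (-x) (by linarith)
    simp only [one_mul, neg_mul, mul_one]
    linarith [Real.exp_pos x, neg_sq x]

/-! ### Existence of the Quicksort law -/

/-- **Lévy's continuity theorem** on the real line. -/
lemma exists_tendsto_of_tendsto_charFun {μ : ℕ → ProbabilityMeasure ℝ} {f : ℝ → ℂ}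
    (hf : ContinuousAt f 0)
    (h : ∀ t, Tendsto (fun n => charFun (μ n : Measure ℝ) t) atTop (𝓝 (f t))) :
    ∃ ν : ProbabilityMeasure ℝ, (∀ t, charFun (ν : Measure ℝ) t = f t) ∧
      Tendsto μ atTop (𝓝 ν) := by
  have h_tight : IsTightMeasureSet (Set.range fun n => (μ n : Measure ℝ)) :=
    isTightMeasureSet_of_tendsto_charFun hf h
  have h_compact : IsCompact (closure (Set.range μ)) :=
    isCompact_closure_of_isTightMeasureSet (by
      convert h_tight using 1
      ext m
      simp)
  -- A limit along a free ultrafilter replaces a convergent subsequence.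
  obtain ⟨ν, -, hν : Tendsto μ _ _⟩ := h_compact.ultrafilter_le_nhds ((hyperfilter ℕ).map μ)
    (le_principal_iff.2 (mem_of_superset range_mem_map subset_closure))
  have hfν : ∀ t, charFun (ν : Measure ℝ) t = f t := by
    intro t
    rw [ProbabilityMeasure.tendsto_iff_forall_integral_rclike_tendsto ℂ] at hν
    have h1 := hν (BoundedContinuousFunction.innerProbChar t)
    simp_rw [← charFun_eq_integral_innerProbChar] at h1
    exact tendsto_nhds_unique h1 ((h t).mono_left Nat.hyperfilter_le_atTop)
  refine ⟨ν, hfν, ProbabilityMeasure.tendsto_of_tendsto_charFun fun t => ?_⟩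
  rw [hfν]
  exact h t

/-- The exponential is unbounded, so weak convergence gives only the inequality of Fatou type, which
suffices. -/
lemma MGFBound.of_tendsto {σ c : ℝ} {μ : ℕ → ProbabilityMeasure ℝ} {ν : ProbabilityMeasure ℝ}
    (hμ : Tendsto μ atTop (𝓝 ν)) (h : ∀ n, MGFBound σ c (μ n : Measure ℝ)) :
    MGFBound σ c (ν : Measure ℝ) := by
  intro θ hθ
  refine (lintegral_le_liminf_lintegral_of_forall_isOpen_measure_le_liminf_measure
    (f := fun x => Real.exp (θ * σ * x)) (by fun_prop) (fun x => (Real.exp_pos _).le)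
    fun G hG => ProbabilityMeasure.le_liminf_measure_open_of_tendsto hμ hG).trans ?_
  exact (liminf_le_liminf (Eventually.of_forall fun n => h n θ hθ)).trans_eq (liminf_const _)

lemma MGFBound.integral_eq_zero {c c' : ℝ} {μ : Measure ℝ} [IsProbabilityMeasure μ]
    (h : MGFBound 1 c μ) (h' : MGFBound (-1) c' μ) : ∫ x, x ∂μ = 0 := by
  have hi : Integrable (fun x : ℝ => x) μ := (h.memLp_two h').integrable (by norm_num)
  have h1 := h.mul_integral_nonpos hi
  have h2 := h'.mul_integral_nonpos hi
  linarith

/-- The exponential bounds are kept in the conclusion because uniqueness transfers them to every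
Quicksort law, which a priori has only finite variance. -/
theorem exists_isQuicksortLaw : ∃ μ : Measure ℝ, IsQuicksortLaw μ ∧ MGFBound 1 1 μ ∧
    MGFBound (-1) (2 * Real.log 2 - 1) μ := by
  set m : ℕ → Measure ℝ := fun n => quicksortTransform^[n] (Measure.dirac 0) with hm
  have hsucc : ∀ n, m (n + 1) = quicksortTransform (m n) := fun n =>
    Function.iterate_succ_apply' _ _ _
  have hp : ∀ n, IsProbabilityMeasure (m n) := by
    intro n
    induction n with
    | zero => exact inferInstanceAs (IsProbabilityMeasure (Measure.dirac (0 : ℝ)))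
    | succ n ih =>
      rw [hsucc]
      infer_instance
  have hR : ∀ n, MGFBound 1 1 (m n) := by
    intro n
    induction n with
    | zero => exact MGFBound.dirac_zero _ _ one_pos
    | succ n ih =>
      rw [hsucc]
      refine ih.quicksortTransform (by simp) one_pos fun u hu => ?_
      rw [one_mul]
      exact quicksortToll_le_one hu.1.le hu.2.le
  have hL : ∀ n, MGFBound (-1) (2 * Real.log 2 - 1) (m n) := by
    intro n
    induction n with
    | zero => exact MGFBound.dirac_zero _ _ two_mul_log_two_sub_one_pos
    | succ n ih =>
      rw [hsucc]
      refine ih.quicksortTransform (by simp) two_mul_log_two_sub_one_pos fun u hu => ?_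
      rw [neg_one_mul]
      exact neg_quicksortToll_le u
  set D := 3 * ∫ x, x ^ 2 ∂(m 1) with hD
  have hm0 : ∀ t, charFun (m 0) t = 1 := fun t => by simp [hm, charFun_dirac]
  have h01 : ∀ t, ‖charFun (m 0) t - charFun (m 1) t‖ ≤ D * t ^ 2 := by
    intro t
    rw [hm0, norm_sub_rev]
    exact norm_charFun_sub_one_le ((hR 1).memLp_two (hL 1)) ((hR 1).integral_eq_zero (hL 1)) t
  have hstep : ∀ n t, ‖charFun (m n) t - charFun (m (n + 1)) t‖ ≤ (D * (2 / 3) ^ n) * t ^ 2 := by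
    intro n
    induction n with
    | zero => simpa using h01
    | succ n ih =>
      intro t
      rw [hsucc n, hsucc (n + 1)]
      exact (charFun_quicksortTransform_contraction ih t).trans_eq (by ring)
  have hdist : ∀ t n, dist (charFun (m n) t) (charFun (m (n + 1)) t) ≤ (D * t ^ 2) * (2 / 3) ^ n :=
    fun t n => by
      rw [dist_eq_norm]
      exact (hstep n t).trans_eq (by ring)
  have hr : (2 / 3 : ℝ) < 1 := by norm_num
  choose f hf using fun t =>
    cauchySeq_tendsto_of_complete (cauchySeq_of_le_geometric _ _ hr (hdist t))
  have hfn : ∀ n t, ‖charFun (m n) t - f t‖ ≤ (3 * D * (2 / 3) ^ n) * t ^ 2 := by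
    intro n t
    rw [← dist_eq_norm]
    exact (dist_le_of_le_geometric_of_tendsto _ _ hr (hdist t) (hf t) n).trans_eq (by ring)
  have hf0 : f 0 = 1 := by
    have := hfn 0 0
    rw [hm0, norm_sub_rev] at this
    exact sub_eq_zero.1 (norm_le_zero_iff.1 (this.trans_eq (by ring)))
  have hfc : ContinuousAt f 0 := by
    rw [ContinuousAt, tendsto_iff_norm_sub_tendsto_zero, hf0]
    refine squeeze_zero (fun _ => norm_nonneg _) (fun t => ?_)
      (show Tendsto (fun t : ℝ => 3 * D * t ^ 2) (𝓝 0) (𝓝 0) from ?_)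
    · have := hfn 0 t
      rw [hm0, norm_sub_rev] at this
      simpa using this
    · have : Continuous fun t : ℝ => 3 * D * t ^ 2 := by fun_prop
      simpa using this.tendsto 0
  obtain ⟨ν, hν, hlim⟩ := exists_tendsto_of_tendsto_charFun (μ := fun n => ⟨m n, hp n⟩) hfc hf
  have hνR : MGFBound 1 1 (ν : Measure ℝ) := MGFBound.of_tendsto hlim hR
  have hνL : MGFBound (-1) (2 * Real.log 2 - 1) (ν : Measure ℝ) := MGFBound.of_tendsto hlim hL
  refine ⟨ν, ⟨inferInstance, hνR.memLp_two hνL, hνR.integral_eq_zero hνL, ?_⟩, hνR, hνL⟩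
  refine Measure.ext_of_charFun (funext fun t => ?_)
  -- The contraction also makes the transform continuous along the iterates, so their limit is a
  -- fixed point.
  have hconv : Tendsto (fun n => charFun (m (n + 1)) t) atTop
      (𝓝 (charFun (quicksortTransform ν) t)) := by
    rw [tendsto_iff_norm_sub_tendsto_zero]
    have hz : Tendsto (fun n : ℕ => 2 / 3 * (3 * D * (2 / 3 : ℝ) ^ n) * t ^ 2) atTop (𝓝 0) := by
      simpa using (((tendsto_pow_atTop_nhds_zero_of_lt_one (by norm_num) hr).const_mul
        (3 * D)).const_mul (2 / 3)).mul_const (t ^ 2)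
    refine squeeze_zero (fun _ => norm_nonneg _) (fun n => ?_) hz
    rw [hsucc]
    refine charFun_quicksortTransform_contraction (fun t => ?_) t
    rw [hν]
    exact hfn n t
  rw [hν]
  exact tendsto_nhds_unique hconv ((tendsto_add_atTop_iff_nat 1).2 (hf t))

theorem existsUnique_isQuicksortLaw : ∃! μ : Measure ℝ, IsQuicksortLaw μ := by
  obtain ⟨μ, hμ, -⟩ := exists_isQuicksortLaw
  exact ⟨μ, hμ, fun ν hν => hν.unique hμ⟩

theorem IsQuicksortLaw.mgfBound {μ : Measure ℝ} (hμ : IsQuicksortLaw μ) :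
    MGFBound 1 1 μ ∧ MGFBound (-1) (2 * Real.log 2 - 1) μ := by
  obtain ⟨ν, hν, h⟩ := exists_isQuicksortLaw
  rwa [hμ.unique hν]

/-! ### Upper bounds for the tails -/

lemma MGFBound.measure_lt_le {σ c : ℝ} {μ : Measure ℝ} (hc : 0 < c) (h : MGFBound σ c μ) {x : ℝ}
    (hx : 1 ≤ x) :
    μ {y | x < σ * y} ≤ ENNReal.ofReal (Real.exp (-(1 / c) * (x * Real.log x) + mgfConst c * x)) := by
  have hlog : 0 ≤ Real.log x := Real.log_nonneg hx
  -- This choice turns `e ^ (c θ)` into `x`, so the bound on the exponent costs only `O(x)`.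
  set θ := Real.log x / c with hθ
  have hθ0 : 0 ≤ θ := div_nonneg hlog hc.le
  have hcθ : c * θ = Real.log x := by
    rw [hθ]
    field_simp
  have hs : MeasurableSet {y : ℝ | x < σ * y} := measurableSet_lt (by fun_prop) (by fun_prop)
  calc μ {y | x < σ * y} = ∫⁻ y, {y | x < σ * y}.indicator 1 y ∂μ := (lintegral_indicator_one hs).symm
    _ ≤ ∫⁻ y, ENNReal.ofReal (Real.exp (-(θ * x))) * ENNReal.ofReal (Real.exp (θ * σ * y)) ∂μ := by
      refine lintegral_mono (indicator_le fun y hy => ?_)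
      rw [← ENNReal.ofReal_mul (Real.exp_pos _).le, ← Real.exp_add, Pi.one_apply,
        ENNReal.one_le_ofReal]
      apply Real.one_le_exp
      have := mul_le_mul_of_nonneg_left (le_of_lt hy : x ≤ σ * y) hθ0
      linarith
    _ ≤ ENNReal.ofReal (Real.exp (-(θ * x))) *
          ENNReal.ofReal (Real.exp (mgfConst c * (Real.exp (c * θ) - 1 - c * θ))) := by
      rw [lintegral_const_mul _ (by fun_prop)]
      exact mul_le_mul_right (h θ hθ0) _
    _ ≤ _ := by
      rw [← ENNReal.ofReal_mul (Real.exp_pos _).le, ← Real.exp_add, hcθ,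
        Real.exp_log (by linarith)]
      refine ENNReal.ofReal_le_ofReal (Real.exp_le_exp.2 (add_le_add (le_of_eq ?_)
        (mul_le_mul_of_nonneg_left (by linarith) (mgfConst_pos hc).le)))
      rw [hθ]
      ring

lemma eventually_mul_log_pos : ∀ᶠ x : ℝ in atTop, 0 < x * Real.log x := by
  filter_upwards [eventually_gt_atTop 1] with x hx
  exact mul_pos (by linarith) (Real.log_pos hx)

lemma log_ofReal_exp_div (r s : ℝ) :
    ENNReal.log (ENNReal.ofReal (Real.exp r)) / (s : EReal) = ((r / s : ℝ) : EReal) := by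
  rw [ENNReal.log_ofReal_of_pos (Real.exp_pos r), Real.log_exp, EReal.coe_div]

lemma eventually_log_div_le {P : ℝ → ENNReal} {r : ℝ → ℝ}
    (h : ∀ᶠ x in atTop, P x ≤ ENNReal.ofReal (Real.exp (r x))) :
    ∀ᶠ x in atTop, ENNReal.log (P x) / ((x * Real.log x : ℝ) : EReal) ≤
      ((r x / (x * Real.log x) : ℝ) : EReal) := by
  filter_upwards [h, eventually_mul_log_pos] with x hx hpos
  rw [← log_ofReal_exp_div]
  exact EReal.div_le_div_right_of_nonneg (by exact_mod_cast hpos.le) (ENNReal.log_monotone hx)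

lemma eventually_le_log_div {P : ℝ → ENNReal} {r : ℝ → ℝ}
    (h : ∀ᶠ x in atTop, ENNReal.ofReal (Real.exp (r x)) ≤ P x) :
    ∀ᶠ x in atTop, ((r x / (x * Real.log x) : ℝ) : EReal) ≤
      ENNReal.log (P x) / ((x * Real.log x : ℝ) : EReal) := by
  filter_upwards [h, eventually_mul_log_pos] with x hx hpos
  rw [← log_ofReal_exp_div]
  exact EReal.div_le_div_right_of_nonneg (by exact_mod_cast hpos.le) (ENNReal.log_monotone hx)

lemma tendsto_upper_rate (c K : ℝ) :
    Tendsto (fun x : ℝ => ((((-(1 / c) * (x * Real.log x) + K * x) / (x * Real.log x) : ℝ)) : EReal))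
      atTop (𝓝 ((-1 / c : ℝ) : EReal)) := by
  refine (continuous_coe_real_ereal.tendsto _).comp ?_
  have h1 : Tendsto (fun x : ℝ => -(1 / c) + K / Real.log x) atTop (𝓝 (-(1 / c) + 0)) :=
    tendsto_const_nhds.add (Real.tendsto_log_atTop.const_div_atTop K)
  rw [add_zero, ← neg_div] at h1
  refine h1.congr' ?_
  filter_upwards [eventually_gt_atTop 1] with x hx
  have hl := Real.log_pos hx
  field_simp

lemma MGFBound.limsup_le {σ c : ℝ} {μ : Measure ℝ} (hc : 0 < c) (h : MGFBound σ c μ) :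
    limsup (fun x : ℝ => ENNReal.log (μ {y | x < σ * y}) / ((x * Real.log x : ℝ) : EReal)) atTop
      ≤ ((-1 / c : ℝ) : EReal) := by
  rw [← (tendsto_upper_rate c (mgfConst c)).limsup_eq]
  refine limsup_le_limsup (eventually_log_div_le ?_)
  filter_upwards [eventually_ge_atTop 1] with x hx
  exact h.measure_lt_le hc hx

/-! ### Lower bound for the right tail -/

namespace IsQuicksortLaw

variable {μ : Measure ℝ}

lemma measure_Ioi_neg_one_pos (hμ : IsQuicksortLaw μ) : 0 < μ (Ioi (-1)) := by
  have := hμ.isProbabilityMeasure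
  rw [pos_iff_ne_zero]
  intro h0
  have hle : ∀ᵐ x ∂μ, x ≤ -1 := by
    rw [ae_iff]
    simp only [not_le]
    exact h0
  have := integral_mono_ae (hμ.memLp_two.integrable (by norm_num)) (integrable_const (-1 : ℝ)) hle
  rw [hμ.integral_eq_zero] at this
  simp at this
  linarith

/-- On `U < κ`, `X₁ > -1`, `X₂ > x`, the sum exceeds `x - U (1 + x) + 1 - η`, and `κ` is small
enough to keep `U (1 + x) ≤ η`. -/
lemma mul_measure_Ioi_le (hμ : IsQuicksortLaw μ) {η δ κ x : ℝ} (hκδ : κ ≤ δ)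
    (hδ1 : δ ≤ 1) (hδ : ∀ u ∈ Ioo 0 δ, 1 - η < quicksortToll u) (hκ : κ * (1 + |x|) ≤ η) :
    ENNReal.ofReal κ * (μ (Ioi (-1)) * μ (Ioi x)) ≤ μ (Ioi (x + (1 - 2 * η))) := by
  have := hμ.isProbabilityMeasure
  conv_rhs => rw [← hμ.fixedPoint, quicksortTransform,
    Measure.map_apply measurable_quicksortMap measurableSet_Ioi]
  have hvol : uniformUnit (Ioo 0 κ) = ENNReal.ofReal κ := by
    rw [uniformUnit, Measure.restrict_apply measurableSet_Ioo,
      inter_eq_left.2 (Ioo_subset_Ioo_right (hκδ.trans hδ1)), Real.volume_Ioo, sub_zero]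
  rw [← hvol, ← Measure.prod_prod, ← Measure.prod_prod]
  refine measure_mono ?_
  rintro ⟨u, a, b⟩ ⟨⟨hu0, huκ⟩, ha, hb⟩
  simp only [mem_Ioi] at ha hb
  simp only [mem_preimage, mem_Ioi]
  have h1 := hδ u ⟨hu0, huκ.trans_le hκδ⟩
  have h2 : u * (1 + x) ≤ η := by
    calc u * (1 + x) ≤ u * (1 + |x|) :=
          mul_le_mul_of_nonneg_left (by linarith [le_abs_self x]) hu0.le
      _ ≤ κ * (1 + |x|) := mul_le_mul_of_nonneg_right huκ.le (by positivity)
      _ ≤ η := hκ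
  have h3 : -u < u * a := by nlinarith
  have h4 : (1 - u) * x ≤ (1 - u) * b :=
    mul_le_mul_of_nonneg_left hb.le (by linarith)
  linarith

end IsQuicksortLaw

lemma exists_forall_lt_quicksortToll {η : ℝ} (hη : 0 < η) :
    ∃ δ, 0 < δ ∧ δ ≤ 1 ∧ ∀ u ∈ Ioo 0 δ, 1 - η < quicksortToll u := by
  have h0 : 1 - η < quicksortToll 0 := by
    rw [quicksortToll_eq, Real.binEntropy_zero]
    linarith
  obtain ⟨ε, hε, h⟩ := Metric.eventually_nhds_iff.1
    (continuous_quicksortToll.continuousAt.eventually_const_lt h0)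
  refine ⟨min ε 1, lt_min hε one_pos, min_le_right _ _, fun u hu => h ?_⟩
  rw [Real.dist_eq, sub_zero, abs_of_pos hu.1]
  exact hu.2.trans_le (min_le_left _ _)

lemma tendsto_log_mul_add_div_log {a : ℝ} (ha : 0 < a) (b : ℝ) :
    Tendsto (fun x : ℝ => Real.log (a * x + b) / Real.log x) atTop (𝓝 1) := by
  have h1 : Tendsto (fun x : ℝ => a + b / x) atTop (𝓝 a) := by
    simpa using (tendsto_const_nhds (x := a)).add (tendsto_id.const_div_atTop b)
  have h2 : Tendsto (fun x : ℝ => 1 + Real.log (a + b / x) / Real.log x) atTop (𝓝 (1 + 0)) :=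
    tendsto_const_nhds.add ((h1.log ha.ne').div_atTop Real.tendsto_log_atTop)
  rw [add_zero] at h2
  refine h2.congr' ?_
  filter_upwards [eventually_gt_atTop 1, h1.eventually_const_lt ha] with x hx hpos
  have hl := Real.log_pos hx
  rw [show a * x + b = x * (a + b / x) by field_simp, Real.log_mul (by linarith) hpos.ne', add_div,
    div_self hl.ne']

lemma tendsto_lower_rate {a : ℝ} (ha : 0 < a) (b α β : ℝ) :
    Tendsto (fun x : ℝ => (-(α * x + β) * Real.log (a * x + b)) / (x * Real.log x))
      atTop (𝓝 (-α)) := by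
  have h1 : Tendsto (fun x : ℝ => -(α + β / x)) atTop (𝓝 (-α)) := by
    simpa using ((tendsto_const_nhds (x := α)).add (tendsto_id.const_div_atTop β)).neg
  have h2 := h1.mul (tendsto_log_mul_add_div_log ha b)
  rw [mul_one] at h2
  refine h2.congr' ?_
  filter_upwards [eventually_gt_atTop 1] with x hx
  have hl := Real.log_pos hx
  field_simp

namespace IsQuicksortLaw

variable {μ : Measure ℝ}

lemma exists_pow_le_measure_Ioi (hμ : IsQuicksortLaw μ) {η : ℝ} (hη : 0 < η) (hη1 : η < 1 / 2) :
    ∃ q, 0 < q ∧ q ≤ 1 ∧ ∀ n : ℕ, ENNReal.ofReal ((q / (n + 2)) ^ (n + 1)) ≤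
      μ (Ioi (-1 + n * (1 - 2 * η))) := by
  have := hμ.isProbabilityMeasure
  obtain ⟨δ, hδ0, hδ1, hδ⟩ := exists_forall_lt_quicksortToll hη
  set p := μ.real (Ioi (-1)) with hp
  have hpμ : μ (Ioi (-1)) = ENNReal.ofReal p := by simp [hp, Measure.real]
  have hp0 : 0 < p := ENNReal.toReal_pos hμ.measure_Ioi_neg_one_pos.ne' (measure_ne_top _ _)
  have hp1 : p ≤ 1 := measureReal_le_one
  set m := min δ η with hm
  have hm0 : 0 < m := lt_min hδ0 hη
  have hm1 : m ≤ 1 := (min_le_left _ _).trans hδ1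
  refine ⟨p * m, mul_pos hp0 hm0, mul_le_one₀ hp1 hm0.le hm1, fun n => ?_⟩
  have hn : (0 : ℝ) < n + 2 := by positivity
  -- The number `n` stays fixed during the induction: all levels reached have modulus at most `1 +
  -- n`, so the one choice `κ = m / (n + 2)` serves every step.
  have key : ∀ k : ℕ, k ≤ n → ENNReal.ofReal (p * (p * m / (n + 2)) ^ k) ≤
      μ (Ioi (-1 + k * (1 - 2 * η))) := by
    intro k
    induction k with
    | zero => intro _; simp [hpμ]
    | succ k ih =>
      intro hk
      have hkn : (k : ℝ) ≤ n := by exact_mod_cast (Nat.le_succ k).trans hk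
      have habs : |(-1 + k * (1 - 2 * η) : ℝ)| ≤ 1 + k := by
        have hk0 : (0 : ℝ) ≤ k := k.cast_nonneg
        rw [abs_le]
        constructor <;> nlinarith
      have h1 := hμ.mul_measure_Ioi_le (κ := m / (n + 2)) (x := -1 + k * (1 - 2 * η))
        ((div_le_self hm0.le (by linarith)).trans (min_le_left _ _)) hδ1 hδ (by
          rw [div_mul_eq_mul_div, div_le_iff₀ hn]
          exact mul_le_mul (min_le_right _ _) (by linarith) (by positivity) hη.le)
      have h2 := ih ((Nat.le_succ k).trans hk)
      calc ENNReal.ofReal (p * (p * m / (n + 2)) ^ (k + 1))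
          = ENNReal.ofReal (m / (n + 2)) *
            (μ (Ioi (-1)) * ENNReal.ofReal (p * (p * m / (n + 2)) ^ k)) := by
            rw [hpμ, ← ENNReal.ofReal_mul hp0.le, ← ENNReal.ofReal_mul (by positivity)]
            congr 1
            ring
        _ ≤ _ := by gcongr
        _ ≤ _ := h1
        _ = _ := by
            congr 2
            push_cast
            ring
  refine le_trans (ENNReal.ofReal_le_ofReal ?_) (key n le_rfl)
  rw [pow_succ']
  refine mul_le_mul_of_nonneg_right ?_ (by positivity)
  rw [div_le_iff₀ hn]
  exact mul_le_mul_of_nonneg_left (by linarith) hp0.le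

lemma exists_exp_le_measure_Ioi (hμ : IsQuicksortLaw μ) {d : ℝ} (hd0 : 0 < d) (hd1 : d < 1) :
    ∃ a b β : ℝ, 0 < a ∧ ∀ x, 0 ≤ x → ENNReal.ofReal
      (Real.exp (-(1 / d * x + β) * Real.log (a * x + b))) ≤ μ (Ioi x) := by
  obtain ⟨q, hq0, hq1, hq⟩ := hμ.exists_pow_le_measure_Ioi (η := (1 - d) / 2)
    (by linarith) (by linarith)
  -- With `n = ⌈(x + 1) / d⌉`, these constants come from `n + 1 ≤ x / d + (1 / d + 2)` and `(n + 2)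
  -- / q ≤ (x / d + 1 / d + 3) / q`.
  refine ⟨1 / (d * q), (1 / d + 3) / q, 1 / d + 2, by positivity, fun x hx => ?_⟩
  set n := ⌈(x + 1) / d⌉₊ with hn
  have hn1 : (x + 1) / d ≤ n := Nat.le_ceil _
  have hn2 : (n : ℝ) < (x + 1) / d + 1 := Nat.ceil_lt_add_one (by positivity)
  have hmono : μ (Ioi (-1 + n * d)) ≤ μ (Ioi x) := by
    refine measure_mono (Ioi_subset_Ioi ?_)
    rw [div_le_iff₀ hd0] at hn1
    linarith
  have h := hq n
  rw [show 1 - 2 * ((1 - d) / 2) = d by ring] at h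
  refine le_trans (ENNReal.ofReal_le_ofReal ?_) (h.trans hmono)
  have hpos : (0 : ℝ) < n + 2 := by positivity
  rw [← Real.exp_log (show 0 < (q / (n + 2)) ^ (n + 1) by positivity), Real.exp_le_exp,
    Real.log_pow, ← inv_div (n + 2 : ℝ) q, Real.log_inv, neg_mul, mul_neg, neg_le_neg_iff]
  have h3 : (x + 1) / d = 1 / d * x + 1 / d := by ring
  refine mul_le_mul ?_ (Real.log_le_log (by positivity) ?_) (Real.log_nonneg ?_) (by positivity)
  · push_cast
    linarith
  · rw [show 1 / (d * q) * x + (1 / d + 3) / q = (1 / d * x + (1 / d + 3)) / q by field_simp]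
    exact div_le_div_of_nonneg_right (by linarith) hq0.le
  · rw [one_le_div hq0]
    have := (n.cast_nonneg : (0 : ℝ) ≤ n)
    linarith

theorem tendsto_right_tail (hμ : IsQuicksortLaw μ) :
    Tendsto (fun x : ℝ => ENNReal.log (μ (Ioi x)) / ((x * Real.log x : ℝ) : EReal))
      atTop (𝓝 (((-1 : ℝ)) : EReal)) := by
  refine tendsto_order.2 ⟨fun a ha => ?_, fun a ha => ?_⟩
  · obtain ⟨r, har, hr⟩ := EReal.lt_iff_exists_real_btwn.1 ha
    rw [EReal.coe_lt_coe_iff] at hr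
    have hd : 1 / -r < 1 := (div_lt_one (by linarith)).2 (by linarith)
    have hd0 : 0 < 1 / -r := div_pos one_pos (by linarith)
    -- A gain `d < 1` per step gives the rate `-1 / d`, which exceeds `r` exactly when `d > 1 /
    -- (-r)`.
    obtain ⟨d, hd1, hd2⟩ := exists_between hd
    have hdpos := hd0.trans hd1
    obtain ⟨A, b, β, hA, hle⟩ := hμ.exists_exp_le_measure_Ioi hdpos hd2
    have hrd : r < -(1 / d) := by
      rw [div_lt_iff₀ (by linarith)] at hd1
      rw [lt_neg, div_lt_iff₀ hdpos]
      linarith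
    filter_upwards [eventually_le_log_div ((eventually_ge_atTop 0).mono hle),
      (tendsto_lower_rate hA b (1 / d) β).eventually_const_lt hrd] with x hx1 hx2
    exact har.trans ((EReal.coe_lt_coe_iff.2 hx2).trans_le hx1)
  · refine eventually_lt_of_limsup_lt (lt_of_le_of_lt ?_ ha)
    simpa [Ioi] using hμ.mgfBound.1.limsup_le one_pos

theorem limsup_left_tail_le (hμ : IsQuicksortLaw μ) :
    limsup (fun x : ℝ => ENNReal.log (μ (Iio (-x))) / ((x * Real.log x : ℝ) : EReal)) atTop
      ≤ ((-1 / (2 * Real.log 2 - 1) : ℝ) : EReal) := by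
  have h := hμ.mgfBound.2.limsup_le two_mul_log_two_sub_one_pos
  have hs : ∀ x : ℝ, {y : ℝ | x < -1 * y} = Iio (-x) := fun x => by
    ext y
    simp only [mem_ofPred_eq, mem_Iio]
    constructor <;> intro h <;> linarith
  simpa only [hs] using h

end IsQuicksortLaw

theorem mainTheorem5 :
    (∃! μ : Measure ℝ, IsQuicksortLaw μ) ∧
    ∀ μ : Measure ℝ, IsQuicksortLaw μ →
      Tendsto (fun x : ℝ => ENNReal.log (μ (Ioi x)) / ((x * Real.log x : ℝ) : EReal))
        atTop (𝓝 (((-1 : ℝ)) : EReal)) ∧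
      limsup (fun x : ℝ => ENNReal.log (μ (Iio (-x))) / ((x * Real.log x : ℝ) : EReal)) atTop
        ≤ ((-1 / (2 * Real.log 2 - 1) : ℝ) : EReal) := by
  exact ⟨existsUnique_isQuicksortLaw, fun _ hμ => ⟨hμ.tendsto_right_tail, hμ.limsup_left_tail_le⟩⟩
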